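/- \textbf{Setting.} Let a finite directed network be given, with a finite set of origin-destination (OD) pairs, demands $q_{od}$ and finite sets $K_{od}$ of candidate paths. A path-flow vector $f=(f_k^{od})$ is \emph{feasible} if $\sum_{k\in K_{od}}f_k^{od}=q_{od}$ for every OD pair, $f\ge 0$, and the link flows $x_a=\sum_{o,d}\sum_{k\in K_{od}}f_k^{od}\delta_{a,k}^{od}$ are nonnegative, where $\delta_{a,k}^{od}\in\{0,1\}$ tells whether path $k$ uses link $a$. Let $0\le\lambda\le\alpha<1$, $\bar\lambda=\frac{\alpha-\lambda}{1+\alpha-2\lambda}$, $\rho>0$, $N\ge 1$ and $\xi^1,\dots,\xi^N\in\mathbb R^m$. Suppose that for each feasible $f$ the cost is affine in $\xi\in\mathbb R^m$, $Z(f,\xi)=Z_0(f)+h(f)^\top\xi$, with $Z_0(f)\in\mathbb R$ and with $h(f)\in\mathbb R^m$ affine in $f$. Put $$g_t(f,\xi)=(1-\bar\lambda)Z(f,\xi)+\tfrac{\bar\lambda}{1-\alpha}\,(Z(f,\xi)-t)_+,$$ $$a_0(f)=(1-\bar\lambda)h(f),\quad b_0(f)=(1-\bar\lambda)Z_0(f),\quad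 a_1(f)=\Bigl(1-\bar\lambda+\tfrac{\bar\lambda}{1-\alpha}\Bigr)h(f),\quad b_1(f,t)=\Bigl(1-\bar\lambda+\tfrac{\bar\lambda}{1-\alpha}\Bigr)Z_0(f)-\tfrac{\bar\lambda}{1-\alpha}t .$$ \textbf{Claim.} \begin{enumerate} \item For all feasible $f$, all $t\in\mathbb R$ and $\xi\in\mathbb R^m$: $g_t(f,\xi)=\max\{a_0(f)^\top\xi+b_0(f),\ a_1(f)^\top\xi+b_1(f,t)\}$. \item For all feasible $f$, all $t\in\mathbb R$, $\kappa\ge 0$ and $i=1,\dots,N$, the inner supremum $\sup_{\xi\in\mathbb R^m}\bigl(g_t(f,\xi)-\kappa\|\xi-\xi^i\|_2\bigr)$ equals $\max\{a_0(f)^\top\xi^i+b_0(f),\ a_1(f)^\top\xi^i+b_1(f,t)\}$ if $\kappa\ge\|a_0(f)\|_2$ and $\kappa\ge\|a_1(f)\|_2$, and equals $+\infty$ otherwise. \item The semi-infinite distributionally robust program $$\min_{f,t,\kappa,s}\ \bar\lambda t+\kappa\rho+\tfrac1N\sum_{i=1}^N s_i\quad\text{s.t. } s_i\ge g_t(f,\xi)-\kappa\|\xi-\xi^i\|_2\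 \ \forall\,\xi\in\mathbb R^m,\ i=1,\dots,N,\quad \kappa\ge 0,\quad t\in\mathbb R,\quad f\text{ feasible}$$ and the finite program $$\min_{f,t,\kappa,s}\ \bar\lambda t+\kappa\rho+\tfrac1N\sum_{i=1}^N s_i\quad\text{s.t. } s_i\ge a_0(f)^\top\xi^i+b_0(f),\ \ s_i\ge a_1(f)^\top\xi^i+b_1(f,t)\ \ (i=1,\dots,N),\quad \|a_0(f)\|_2\le\kappa,\ \ \|a_1(f)\|_2\le\kappa,\quad f\text{ feasible}$$ have the same feasible set and the same objective, hence the same optimal value and the same optimal solutions. \item The finite program is a second-order cone program up to the term $Z_0(f)$: its objective is linear, and there is a set $K$ of vectors $(f,t,\kappa,s,r)$, given by finitely many constraints of the form $\|Ay+b\|_2\le c^\top y+d$, such that $(f,t,\kappa,s)$ is feasible if and only if $(f,t,\kappa,s,r)\in K$ for some real $r\ge Z_0(f)$. If $Z_0$ is also affine in $f$ on the set of feasible $f$, the finite program is itself a second-order cone program, that is, a linear objective minimized under finitely many constraints $\|Ay+b\|_2\le c^\top y+d$ on $y=(f,t,\kappa,s)$. \end{enumerate} -/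

import Mathlib

noncomputable section

/-! ### Transportation network, path flows and their constraints -/

/-- `l` is a list of consecutive directed links leading from node `o` to node `d`. -/
def IsRoute {V E : Type*} (src tgt : E → V) : V → V → List E → Prop
  | o, d, [] => o = d
  | o, d, a :: l => src a = o ∧ IsRoute src tgt (tgt a) d l

/-- A directed network with node set `V` and link set `E`, a finite set of origin-destination
pairs, a demand for each pair, and for each pair a finite set of candidate paths. A path is
the list of its links; no link is repeated. -/
structure TrafficNetwork (V E : Type*) where
  src : E → V
  tgt : E → V
  od : Finset (V × V)
  demand : V × V → ℝ
  paths : V × V → Finset (List E)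
  paths_isRoute : ∀ p ∈ od, ∀ k ∈ paths p, IsRoute src tgt p.1 p.2 k
  paths_nodup : ∀ p ∈ od, ∀ k ∈ paths p, k.Nodup

namespace TrafficNetwork

variable {V E : Type*} (G : TrafficNetwork V E)

/-- Pairs (OD pair, candidate path of that pair). -/
abbrev PathIndex : Type _ := Σ p : G.od, G.paths p

/-- Vectors of path flows `f_k^{od}`. -/
abbrev PathFlow : Type _ := G.PathIndex → ℝ

open Classical in
/-- The 0/1 link-path incidence `δ_{a,k}`. -/
def incidence (a : E) (j : G.PathIndex) : ℝ := if a ∈ (j.2 : List E) then 1 else 0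

/-- The link flow `x_a = ∑_{o,d} ∑_k f_k^{od} δ_{a,k}^{od}`. -/
def linkFlow (f : G.PathFlow) (a : E) : ℝ := ∑ j : G.PathIndex, f j * G.incidence a j

/-- Demand conservation, with nonnegative path flows and link flows. -/
def FeasibleFlow (f : G.PathFlow) : Prop :=
  (∀ p : G.od, ∑ k : G.paths p, f ⟨p, k⟩ = G.demand p) ∧
  (∀ j, 0 ≤ f j) ∧ (∀ a, 0 ≤ G.linkFlow f a)

/-- The decision vectors `(f, t, κ, s)` with `s ∈ ℝⁿ`. -/
abbrev Decision (n : ℕ) : Type _ := G.PathFlow × ℝ × ℝ × (Fin n → ℝ)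

end TrafficNetwork

/-! ### Optimization problems and second-order cone programs -/

/-- The problem of minimizing `objective` over `feasible`. -/
structure MinProblem (X : Type*) where
  objective : X → ℝ
  feasible : Set X

namespace MinProblem

variable {X : Type*}

/-- The optimal value, `+∞` for an infeasible and `-∞` for an unbounded problem. -/
def value (P : MinProblem X) : EReal := ⨅ x ∈ P.feasible, (P.objective x : EReal)

/-- The set of optimal solutions. -/
def minimizers (P : MinProblem X) : Set X :=
  {x | x ∈ P.feasible ∧ ∀ y ∈ P.feasible, P.objective x ≤ P.objective y}

end MinProblem

/-- A second-order cone constraint `‖A x + b‖₂ ≤ cᵀ x + d`; `lhs` is `x ↦ A x + b` and `rhs` is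
`x ↦ cᵀ x + d`. With `dim = 0` this is an affine inequality, and two such
inequalities form an affine equality. -/
structure SOCConstraint (X : Type*) [AddCommGroup X] [Module ℝ X] where
  dim : ℕ
  lhs : X →ᵃ[ℝ] EuclideanSpace ℝ (Fin dim)
  rhs : X →ᵃ[ℝ] ℝ

/-- The constraint is satisfied at `x`. -/
def SOCConstraint.Holds {X : Type*} [AddCommGroup X] [Module ℝ X] (C : SOCConstraint X)
    (x : X) : Prop := ‖C.lhs x‖ ≤ C.rhs x

/-- `S` is the solution set of finitely many second-order cone constraints. -/
def IsSOCSet {X : Type*} [AddCommGroup X] [Module ℝ X] (S : Set X) : Prop :=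
  ∃ (J : ℕ) (C : Fin J → SOCConstraint X), S = {x | ∀ j, (C j).Holds x}

/-- A second-order cone program: a linear objective, minimized under finitely many
second-order cone constraints. -/
def MinProblem.IsSOCP {X : Type*} [AddCommGroup X] [Module ℝ X] (P : MinProblem X) : Prop :=
  (∃ c : X →ₗ[ℝ] ℝ, ∀ x, P.objective x = c x) ∧ IsSOCSet P.feasible

/-! ### The semi-infinite program and its conic form -/

/-- The effective mixing weight `(α - λ) / (1 + α - 2 λ)`. -/
def effectiveWeight (α lam : ℝ) : ℝ := (α - lam) / (1 + α - 2 * lam)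

section Programs

variable {F : Type*} {m n : ℕ}

/-- The hinge-augmented payoff
`g_t(f, ξ) = (1 - w) Z(f, ξ) + w / (1 - α) * (Z(f, ξ) - t)₊`, `w` the effective weight. -/
def hingePayoff (α lam : ℝ) (Z : F → EuclideanSpace ℝ (Fin m) → ℝ) (t : ℝ) (f : F)
    (ξ : EuclideanSpace ℝ (Fin m)) : ℝ :=
  (1 - effectiveWeight α lam) * Z f ξ
    + effectiveWeight α lam / (1 - α) * max (Z f ξ - t) 0

/-- The inner supremum `sup_ξ (g_t(f, ξ) - κ ‖ξ - ξ'‖)`, in the extended reals. -/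
def innerSup (α lam : ℝ) (Z : F → EuclideanSpace ℝ (Fin m) → ℝ) (t κ : ℝ) (f : F)
    (ξ' : EuclideanSpace ℝ (Fin m)) : EReal :=
  ⨆ ξ : EuclideanSpace ℝ (Fin m), ((hingePayoff α lam Z t f ξ - κ * ‖ξ - ξ'‖ : ℝ) : EReal)

/-- Slope of the first affine piece. -/
def slope0 (α lam : ℝ) (h : F → EuclideanSpace ℝ (Fin m)) (f : F) :
    EuclideanSpace ℝ (Fin m) := (1 - effectiveWeight α lam) • h f

/-- Intercept of the first affine piece. -/
def intercept0 (α lam : ℝ) (Z₀ : F → ℝ) (f : F) : ℝ := (1 - effectiveWeight α lam) * Z₀ f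

/-- Slope of the second affine piece. -/
def slope1 (α lam : ℝ) (h : F → EuclideanSpace ℝ (Fin m)) (f : F) :
    EuclideanSpace ℝ (Fin m) :=
  (1 - effectiveWeight α lam + effectiveWeight α lam / (1 - α)) • h f

/-- Intercept of the second affine piece. -/
def intercept1 (α lam : ℝ) (Z₀ : F → ℝ) (f : F) (t : ℝ) : ℝ :=
  (1 - effectiveWeight α lam + effectiveWeight α lam / (1 - α)) * Z₀ f
    - effectiveWeight α lam / (1 - α) * t

variable {V E : Type*} (G : TrafficNetwork V E)

/-- The common objective `w t + κ ρ + (1/n) ∑ᵢ sᵢ`, `w` the effective weight. -/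
def droObjective (α lam ρ : ℝ) (x : G.Decision n) : ℝ :=
  match x with
  | (_, t, κ, s) => effectiveWeight α lam * t + κ * ρ + 1 / (n : ℝ) * ∑ i, s i

/-- The semi-infinite program: minimize `w t + κ ρ + (1/n) ∑ᵢ sᵢ` over feasible path flows `f`,
`t ∈ ℝ`, `κ ≥ 0` and `s`, subject to `sᵢ ≥ g_t(f, ξ) - κ ‖ξ - ξⁱ‖` for all `ξ ∈ ℝᵐ` and all `i`. -/
def semiInfiniteProgram (α lam ρ : ℝ) (Z : G.PathFlow → EuclideanSpace ℝ (Fin m) → ℝ)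
    (sample : Fin n → EuclideanSpace ℝ (Fin m)) : MinProblem (G.Decision n) where
  objective := droObjective G α lam ρ
  feasible := {x | match x with
    | (f, t, κ, s) =>
      (∀ ξ : EuclideanSpace ℝ (Fin m), ∀ i,
        hingePayoff α lam Z t f ξ - κ * ‖ξ - sample i‖ ≤ s i) ∧
      0 ≤ κ ∧ G.FeasibleFlow f}

/-- The finite conic program: the same objective, subject to `sᵢ ≥ a₀(f)ᵀ ξⁱ + b₀(f)`,
`sᵢ ≥ a₁(f)ᵀ ξⁱ + b₁(f, t)`, `‖a₀(f)‖ ≤ κ`, `‖a₁(f)‖ ≤ κ` and `f` feasible. -/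
def conicProgram (α lam ρ : ℝ) (Z₀ : G.PathFlow → ℝ) (h : G.PathFlow → EuclideanSpace ℝ (Fin m))
    (sample : Fin n → EuclideanSpace ℝ (Fin m)) : MinProblem (G.Decision n) where
  objective := droObjective G α lam ρ
  feasible := {x | match x with
    | (f, t, κ, s) =>
      (∀ i, inner ℝ (slope0 α lam h f) (sample i) + intercept0 α lam Z₀ f ≤ s i) ∧
      (∀ i, inner ℝ (slope1 α lam h f) (sample i) + intercept1 α lam Z₀ f t ≤ s i) ∧
      ‖slope0 α lam h f‖ ≤ κ ∧ ‖slope1 α lam h f‖ ≤ κ ∧ G.FeasibleFlow f}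

end Programs

end

/-! The hinge coefficient `w / (1 - α)` is nonnegative, so the payoff is a maximum of two affine
functions of `ξ`, according to whether the hinge is active. An affine function with slope `a`, minus
`κ ‖ξ - c‖`, is maximal at `c` when `‖a‖ ≤ κ`, by Cauchy-Schwarz, and otherwise grows without bound
along the ray from `c` in direction `a`. Hence the penalized payoff is bounded above exactly when
`κ` dominates both slopes, and its supremum is then the payoff at `c`. This replaces the infinitely
many constraints by two norm bounds and two inequalities per sample.

For the conic form, every constraint is affine or a norm bound, apart from `Z₀`. It occurs only on
the smaller side of inequalities, with nonnegative coefficients, so an epigraph variable `r ≥ Z₀ f`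
can replace it. -/

noncomputable section

/-! ### Affine functions with a norm penalty -/

section Penalty

variable {H : Type*} [NormedAddCommGroup H] [InnerProductSpace ℝ H]

/-- An affine function minus a norm penalty that dominates its slope is maximal at the centre. -/
theorem inner_add_sub_penalty_le {a : H} {κ : ℝ} (ha : ‖a‖ ≤ κ) (b : ℝ) (x c : H) :
    inner ℝ a x + b - κ * ‖x - c‖ ≤ inner ℝ a c + b := by
  have h1 : inner ℝ a (x - c) ≤ ‖a‖ * ‖x - c‖ := real_inner_le_norm a (x - c)
  have h2 : ‖a‖ * ‖x - c‖ ≤ κ * ‖x - c‖ := by gcongr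
  rw [inner_sub_right] at h1
  linarith

/-- If an affine function minus a norm penalty is bounded above, the penalty dominates the
slope. -/
theorem norm_le_of_forall_inner_add_sub_penalty_le {a c : H} {b κ C : ℝ} (hκ : 0 ≤ κ)
    (hC : ∀ x : H, inner ℝ a x + b - κ * ‖x - c‖ ≤ C) : ‖a‖ ≤ κ := by
  by_contra! hlt
  -- At `c + k • a` the penalized function equals its value at `c` plus `k * (‖a‖ * (‖a‖ - κ))`,
  -- which exceeds `C` for large `k`.
  have hpos : 0 < ‖a‖ * (‖a‖ - κ) := mul_pos (hκ.trans_lt hlt) (sub_pos.2 hlt)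
  obtain ⟨k, hk⟩ := exists_nat_gt ((C - (inner ℝ a c + b)) / (‖a‖ * (‖a‖ - κ)))
  rw [div_lt_iff₀ hpos] at hk
  have h1 := hC (c + (k : ℝ) • a)
  rw [inner_add_right, inner_smul_right, real_inner_self_eq_norm_sq, add_sub_cancel_left,
    norm_smul, Real.norm_natCast] at h1
  nlinarith

end Penalty

/-! ### Sets described by second-order cone constraints -/

namespace IsSOCSet

variable {X Y : Type*} [AddCommGroup X] [Module ℝ X] [AddCommGroup Y] [Module ℝ Y]

theorem of_finite {ι : Type*} [Finite ι] (C : ι → SOCConstraint X) :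
    IsSOCSet {x | ∀ i, (C i).Holds x} := by
  obtain ⟨J, ⟨e⟩⟩ := Finite.exists_equiv_fin ι
  refine ⟨J, fun j => C (e.symm j), ?_⟩
  ext x
  exact ⟨fun hx j => hx _, fun hx i => by simpa using hx (e i)⟩

theorem setOf_forall {ι : Type*} [Finite ι] {p : ι → X → Prop}
    (hp : ∀ i, IsSOCSet {x | p i x}) : IsSOCSet {x | ∀ i, p i x} := by
  choose J C hC using hp
  have : {x | ∀ i, p i x} = {x | ∀ j : Σ i, Fin (J i), (C j.1 j.2).Holds x} := by
    ext x
    simp only [Set.mem_ofPred_eq, Sigma.forall]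
    exact forall_congr' fun i => Set.ext_iff.1 (hC i) x
  rw [this]
  exact of_finite _

theorem setOf_and {p q : X → Prop} (hp : IsSOCSet {x | p x}) (hq : IsSOCSet {x | q x}) :
    IsSOCSet {x | p x ∧ q x} := by
  have : {x | p x ∧ q x} = {x | ∀ b : Bool, (bif b then p x else q x)} := by
    ext x
    simp [and_comm]
  rw [this]
  refine setOf_forall fun b => ?_
  cases b
  · exact hq
  · exact hp

theorem setOf_norm_le {d : ℕ} (L : X →ᵃ[ℝ] EuclideanSpace ℝ (Fin d)) (k : X →ᵃ[ℝ] ℝ) :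
    IsSOCSet {x | ‖L x‖ ≤ k x} :=
  ⟨1, fun _ => ⟨d, L, k⟩, by ext x; simp [SOCConstraint.Holds]⟩

theorem setOf_le (g k : X →ᵃ[ℝ] ℝ) : IsSOCSet {x | g x ≤ k x} := by
  simpa using setOf_norm_le (0 : X →ᵃ[ℝ] EuclideanSpace ℝ (Fin 0)) (k - g)

theorem setOf_eq (g k : X →ᵃ[ℝ] ℝ) : IsSOCSet {x | g x = k x} := by
  simpa only [le_antisymm_iff] using (setOf_le g k).setOf_and (setOf_le k g)

theorem preimage {S : Set Y} (hS : IsSOCSet S) (L : X →ᵃ[ℝ] Y) : IsSOCSet {x | L x ∈ S} := by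
  obtain ⟨J, C, rfl⟩ := hS
  exact ⟨J, fun j => ⟨(C j).dim, (C j).lhs.comp L, (C j).rhs.comp L⟩, rfl⟩

end IsSOCSet

theorem TrafficNetwork.isSOCSet_feasibleFlow {V E : Type*} [Finite E] (G : TrafficNetwork V E) :
    IsSOCSet {f | G.FeasibleFlow f} := by
  let coord (j : G.PathIndex) : G.PathFlow →ₗ[ℝ] ℝ := LinearMap.proj j
  have hdemand (p : G.od) : IsSOCSet {f : G.PathFlow | ∑ k, f ⟨p, k⟩ = G.demand p} := by
    convert IsSOCSet.setOf_eq (∑ k : G.paths p, coord ⟨p, k⟩).toAffineMap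
      (AffineMap.const ℝ _ (G.demand p)) using 4
    · simp [coord, LinearMap.sum_apply]
    · rfl
  have hpath (j : G.PathIndex) : IsSOCSet {f : G.PathFlow | 0 ≤ f j} :=
    IsSOCSet.setOf_le 0 (coord j).toAffineMap
  have hlink (a : E) : IsSOCSet {f | 0 ≤ G.linkFlow f a} := by
    convert IsSOCSet.setOf_le 0 (∑ j, G.incidence a j • coord j).toAffineMap using 4
    · rfl
    · simp [coord, LinearMap.sum_apply, TrafficNetwork.linkFlow, mul_comm]
  exact .setOf_and (.setOf_forall hdemand) (.setOf_and (.setOf_forall hpath) (.setOf_forall hlink))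

/-! ### The weights -/

section Weights

variable {α lam : ℝ}

/-- The denominator is `(1 - α) + 2 * (α - lam)`, hence positive. -/
theorem effectiveWeight_nonneg (hlamα : lam ≤ α) (hα : α < 1) : 0 ≤ effectiveWeight α lam :=
  div_nonneg (by linarith) (by linarith)

theorem effectiveWeight_le_one (hlamα : lam ≤ α) (hα : α < 1) : effectiveWeight α lam ≤ 1 :=
  (div_le_one (by linarith)).2 (by linarith)

theorem hinge_coeff_nonneg (hlamα : lam ≤ α) (hα : α < 1) :
    0 ≤ effectiveWeight α lam / (1 - α) :=
  div_nonneg (effectiveWeight_nonneg hlamα hα) (by linarith)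

/-- Makes the second intercept monotone in `Z₀`, as the epigraph reformulation requires. -/
theorem slope1_coeff_nonneg (hlamα : lam ≤ α) (hα : α < 1) :
    0 ≤ 1 - effectiveWeight α lam + effectiveWeight α lam / (1 - α) :=
  add_nonneg (sub_nonneg.2 (effectiveWeight_le_one hlamα hα)) (hinge_coeff_nonneg hlamα hα)

end Weights

/-! ### The payoff and the inner supremum -/

section Payoff

variable {F : Type*} {m : ℕ} {α lam : ℝ} {Z : F → EuclideanSpace ℝ (Fin m) → ℝ} {Z₀ : F → ℝ}
  {h : F → EuclideanSpace ℝ (Fin m)} {f : F}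

theorem hingePayoff_eq_max (hlamα : lam ≤ α) (hα : α < 1)
    (hZ : ∀ ξ, Z f ξ = Z₀ f + inner ℝ (h f) ξ) (t : ℝ) (ξ : EuclideanSpace ℝ (Fin m)) :
    hingePayoff α lam Z t f ξ =
      max (inner ℝ (slope0 α lam h f) ξ + intercept0 α lam Z₀ f)
        (inner ℝ (slope1 α lam h f) ξ + intercept1 α lam Z₀ f t) := by
  -- Nonnegativity of the coefficient lets it pass inside the maximum; `max_comm` then puts the
  -- piece with inactive hinge first.
  rw [hingePayoff, mul_max_of_nonneg _ _ (hinge_coeff_nonneg hlamα hα), ← max_add_add_left,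
    max_comm, hZ]
  simp only [slope0, slope1, intercept0, intercept1, real_inner_smul_left]
  congr 1 <;> ring

theorem penalized_hingePayoff_le (hlamα : lam ≤ α) (hα : α < 1)
    (hZ : ∀ ξ, Z f ξ = Z₀ f + inner ℝ (h f) ξ) {κ : ℝ} (h0 : ‖slope0 α lam h f‖ ≤ κ)
    (h1 : ‖slope1 α lam h f‖ ≤ κ) (t : ℝ) (ξ c : EuclideanSpace ℝ (Fin m)) :
    hingePayoff α lam Z t f ξ - κ * ‖ξ - c‖ ≤
      max (inner ℝ (slope0 α lam h f) c + intercept0 α lam Z₀ f)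
        (inner ℝ (slope1 α lam h f) c + intercept1 α lam Z₀ f t) := by
  rw [hingePayoff_eq_max hlamα hα hZ, ← max_sub_sub_right]
  exact max_le_max (inner_add_sub_penalty_le h0 _ _ _) (inner_add_sub_penalty_le h1 _ _ _)

/-- A bound on the maximum bounds each affine piece, and each bounded piece forces its own slope
condition. -/
theorem norm_slopes_le_of_penalized_hingePayoff_le (hlamα : lam ≤ α) (hα : α < 1)
    (hZ : ∀ ξ, Z f ξ = Z₀ f + inner ℝ (h f) ξ) {t κ C : ℝ} (hκ : 0 ≤ κ)
    {c : EuclideanSpace ℝ (Fin m)}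
    (hC : ∀ ξ, hingePayoff α lam Z t f ξ - κ * ‖ξ - c‖ ≤ C) :
    ‖slope0 α lam h f‖ ≤ κ ∧ ‖slope1 α lam h f‖ ≤ κ := by
  simp only [hingePayoff_eq_max hlamα hα hZ, ← max_sub_sub_right] at hC
  exact ⟨norm_le_of_forall_inner_add_sub_penalty_le hκ fun ξ => (le_max_left _ _).trans (hC ξ),
    norm_le_of_forall_inner_add_sub_penalty_le hκ fun ξ => (le_max_right _ _).trans (hC ξ)⟩

theorem innerSup_eq_max (hlamα : lam ≤ α) (hα : α < 1)
    (hZ : ∀ ξ, Z f ξ = Z₀ f + inner ℝ (h f) ξ) {κ : ℝ} (h0 : ‖slope0 α lam h f‖ ≤ κ)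
    (h1 : ‖slope1 α lam h f‖ ≤ κ) (t : ℝ) (c : EuclideanSpace ℝ (Fin m)) :
    innerSup α lam Z t κ f c =
      ((max (inner ℝ (slope0 α lam h f) c + intercept0 α lam Z₀ f)
        (inner ℝ (slope1 α lam h f) c + intercept1 α lam Z₀ f t) : ℝ) : EReal) := by
  refine le_antisymm (iSup_le fun ξ => EReal.coe_le_coe_iff.2
    (penalized_hingePayoff_le hlamα hα hZ h0 h1 t ξ c)) (le_iSup_of_le c ?_)
  simp [hingePayoff_eq_max hlamα hα hZ]

theorem innerSup_eq_top (hlamα : lam ≤ α) (hα : α < 1)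
    (hZ : ∀ ξ, Z f ξ = Z₀ f + inner ℝ (h f) ξ) {κ : ℝ} (hκ : 0 ≤ κ)
    (hn : ¬ (‖slope0 α lam h f‖ ≤ κ ∧ ‖slope1 α lam h f‖ ≤ κ)) (t : ℝ)
    (c : EuclideanSpace ℝ (Fin m)) : innerSup α lam Z t κ f c = ⊤ := by
  -- A supremum bounded by some real `C` would force both slope bounds.
  refine EReal.eq_top_iff_forall_lt _ |>.2 fun C => ?_
  by_contra! hle
  exact hn (norm_slopes_le_of_penalized_hingePayoff_le hlamα hα hZ hκ fun ξ =>
    EReal.coe_le_coe_iff.1 ((le_iSup (fun ξ : EuclideanSpace ℝ (Fin m) =>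
      ((hingePayoff α lam Z t f ξ - κ * ‖ξ - c‖ : ℝ) : EReal)) ξ).trans hle))

end Payoff

/-! ### The two programs -/

section Programs

variable {V E : Type*} {G : TrafficNetwork V E} {m n : ℕ} {α lam : ℝ}

theorem semiInfiniteProgram_feasible_eq (hn : 1 ≤ n) (hlamα : lam ≤ α) (hα : α < 1) (ρ : ℝ)
    (sample : Fin n → EuclideanSpace ℝ (Fin m)) {Z : G.PathFlow → EuclideanSpace ℝ (Fin m) → ℝ}
    {Z₀ : G.PathFlow → ℝ} {h : G.PathFlow → EuclideanSpace ℝ (Fin m)}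
    (hZ : ∀ f, G.FeasibleFlow f → ∀ ξ, Z f ξ = Z₀ f + inner ℝ (h f) ξ) :
    (semiInfiniteProgram G α lam ρ Z sample).feasible =
      (conicProgram G α lam ρ Z₀ h sample).feasible := by
  ext ⟨f, t, κ, s⟩
  constructor
  · rintro ⟨hs, hκ, hf⟩
    -- One sample suffices to force both norm bounds; with no samples the semi-infinite constraints
    -- would be vacuous.
    obtain ⟨h0, h1⟩ := norm_slopes_le_of_penalized_hingePayoff_le hlamα hα (hZ f hf) hκ
      fun ξ => hs ξ ⟨0, hn⟩
    -- At `ξ = sample i` the penalty vanishes.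
    have hmax : ∀ i, _ := fun i => hs (sample i) i
    simp only [hingePayoff_eq_max hlamα hα (hZ f hf), sub_self, norm_zero, mul_zero, sub_zero,
      max_le_iff] at hmax
    exact ⟨fun i => (hmax i).1, fun i => (hmax i).2, h0, h1, hf⟩
  · rintro ⟨hs0, hs1, h0, h1, hf⟩
    exact ⟨fun ξ i => (penalized_hingePayoff_le hlamα hα (hZ f hf) h0 h1 t ξ _).trans
      (max_le (hs0 i) (hs1 i)), (norm_nonneg _).trans h0, hf⟩

theorem exists_linearMap_eq_droObjective (ρ : ℝ) :
    ∃ c : G.Decision n →ₗ[ℝ] ℝ, ∀ x, droObjective G α lam ρ x = c x := by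
  refine ⟨LinearMap.coprod 0 (LinearMap.coprod (effectiveWeight α lam • LinearMap.id)
    (LinearMap.coprod (ρ • LinearMap.id)
      ((1 / (n : ℝ)) • ∑ i, LinearMap.proj i))), ?_⟩
  rintro ⟨f, t, κ, s⟩
  simp [droObjective, LinearMap.sum_apply]
  ring

/-- The constraints of the conic program, with the intercept replaced by an affine function `R`
and the decision variables by affine functions on an arbitrary space, are second-order cone
constraints. -/
theorem isSOCSet_conic_constraints {X : Type*} [AddCommGroup X] [Module ℝ X] [Finite E]
    (sample : Fin n → EuclideanSpace ℝ (Fin m))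
    (h : G.PathFlow →ᵃ[ℝ] EuclideanSpace ℝ (Fin m)) (D : X →ᵃ[ℝ] G.Decision n) (R : X →ᵃ[ℝ] ℝ) :
    IsSOCSet {x | (∀ i, inner ℝ (slope0 α lam h (D x).1) (sample i)
          + (1 - effectiveWeight α lam) * R x ≤ (D x).2.2.2 i) ∧
      (∀ i, inner ℝ (slope1 α lam h (D x).1) (sample i)
          + ((1 - effectiveWeight α lam + effectiveWeight α lam / (1 - α)) * R x
            - effectiveWeight α lam / (1 - α) * (D x).2.1) ≤ (D x).2.2.2 i) ∧
      ‖slope0 α lam h (D x).1‖ ≤ (D x).2.2.1 ∧ ‖slope1 α lam h (D x).1‖ ≤ (D x).2.2.1 ∧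
      G.FeasibleFlow (D x).1} := by
  let A := G.PathFlow
  let f : X →ᵃ[ℝ] A := (LinearMap.fst ℝ A (ℝ × ℝ × (Fin n → ℝ))).toAffineMap.comp D
  let D₁ : X →ᵃ[ℝ] ℝ × ℝ × (Fin n → ℝ) := (LinearMap.snd ℝ A _).toAffineMap.comp D
  let t : X →ᵃ[ℝ] ℝ := (LinearMap.fst ℝ ℝ (ℝ × (Fin n → ℝ))).toAffineMap.comp D₁
  let D₂ : X →ᵃ[ℝ] ℝ × (Fin n → ℝ) := (LinearMap.snd ℝ ℝ _).toAffineMap.comp D₁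
  let κ : X →ᵃ[ℝ] ℝ := (LinearMap.fst ℝ ℝ (Fin n → ℝ)).toAffineMap.comp D₂
  let s (i : Fin n) : X →ᵃ[ℝ] ℝ :=
    ((LinearMap.proj i).comp (LinearMap.snd ℝ ℝ (Fin n → ℝ))).toAffineMap.comp D₂
  let a (c : ℝ) : X →ᵃ[ℝ] EuclideanSpace ℝ (Fin m) := c • h.comp f
  -- The sample is the fixed argument of the inner product, so `p` is affine in the decision.
  let p (c : ℝ) (i : Fin n) : X →ᵃ[ℝ] ℝ := (innerₗ _ (sample i)).toAffineMap.comp (a c)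
  refine .setOf_and (.setOf_forall fun i => ?_) (.setOf_and (.setOf_forall fun i => ?_)
    (.setOf_and (.setOf_norm_le (a _) κ) (.setOf_and (.setOf_norm_le (a _) κ)
      (G.isSOCSet_feasibleFlow.preimage f))))
  · convert IsSOCSet.setOf_le (p (1 - effectiveWeight α lam) i
      + (1 - effectiveWeight α lam) • R) (s i) using 4
    · simp [p, a, f, slope0, real_inner_comm, inner_smul_right]
    · rfl
  · convert IsSOCSet.setOf_le (p (1 - effectiveWeight α lam + effectiveWeight α lam / (1 - α)) i
      + ((1 - effectiveWeight α lam + effectiveWeight α lam / (1 - α)) • R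
        - (effectiveWeight α lam / (1 - α)) • t)) (s i) using 4
    · simp [p, a, f, t, D₁, slope1, real_inner_comm, inner_smul_right]
    · rfl

end Programs

end

theorem mainTheorem3 {V E : Type*} [Fintype V] [Fintype E] (G : TrafficNetwork V E)
    {m n : ℕ} (hn : 1 ≤ n) (α lam ρ : ℝ) (hlam : 0 ≤ lam) (hlamα : lam ≤ α) (hα : α < 1)
    (hρ : 0 < ρ) (sample : Fin n → EuclideanSpace ℝ (Fin m))
    (Z : G.PathFlow → EuclideanSpace ℝ (Fin m) → ℝ) (Z₀ : G.PathFlow → ℝ)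
    (h : G.PathFlow →ᵃ[ℝ] EuclideanSpace ℝ (Fin m))
    (hZ : ∀ f, G.FeasibleFlow f → ∀ ξ, Z f ξ = Z₀ f + inner ℝ (h f) ξ) :
    -- the payoff is the maximum of the two affine pieces
    (∀ f, G.FeasibleFlow f → ∀ t ξ, hingePayoff α lam Z t f ξ =
      max (inner ℝ (slope0 α lam h f) ξ + intercept0 α lam Z₀ f)
        (inner ℝ (slope1 α lam h f) ξ + intercept1 α lam Z₀ f t)) ∧
    -- the inner suprema
    (∀ f, G.FeasibleFlow f → ∀ t κ, 0 ≤ κ → ∀ i,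
      (‖slope0 α lam h f‖ ≤ κ ∧ ‖slope1 α lam h f‖ ≤ κ →
        innerSup α lam Z t κ f (sample i) =
          ((max (inner ℝ (slope0 α lam h f) (sample i) + intercept0 α lam Z₀ f)
            (inner ℝ (slope1 α lam h f) (sample i) + intercept1 α lam Z₀ f t) : ℝ) : EReal)) ∧
      (¬ (‖slope0 α lam h f‖ ≤ κ ∧ ‖slope1 α lam h f‖ ≤ κ) →
        innerSup α lam Z t κ f (sample i) = ⊤)) ∧
    -- equivalence of the two programs
    ((semiInfiniteProgram G α lam ρ Z sample).feasible =
        (conicProgram G α lam ρ Z₀ h sample).feasible ∧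
      (∀ x, (semiInfiniteProgram G α lam ρ Z sample).objective x =
        (conicProgram G α lam ρ Z₀ h sample).objective x) ∧
      (semiInfiniteProgram G α lam ρ Z sample).value =
        (conicProgram G α lam ρ Z₀ h sample).value ∧
      (semiInfiniteProgram G α lam ρ Z sample).minimizers =
        (conicProgram G α lam ρ Z₀ h sample).minimizers) ∧
    -- the objective is linear, and the constraints are second-order cone constraints in
    -- `(f, t, κ, s, r)` together with the single constraint `Z₀(f) ≤ r`
    ((∃ c : G.Decision n →ₗ[ℝ] ℝ, ∀ x, (conicProgram G α lam ρ Z₀ h sample).objective x = c x) ∧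
      ∃ K : Set (G.Decision n × ℝ), IsSOCSet K ∧
        (conicProgram G α lam ρ Z₀ h sample).feasible = {x | ∃ r, Z₀ x.1 ≤ r ∧ (x, r) ∈ K}) ∧
    -- if the intercept is affine as well, it is a second-order cone program
    ((∃ ℓ : G.PathFlow →ᵃ[ℝ] ℝ, ∀ f, G.FeasibleFlow f → Z₀ f = ℓ f) →
      (conicProgram G α lam ρ Z₀ h sample).IsSOCP) := by
  have hfeas := semiInfiniteProgram_feasible_eq hn hlamα hα ρ sample hZ
  refine ⟨fun f hf => hingePayoff_eq_max hlamα hα (hZ f hf),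
    fun f hf t κ hκ i => ⟨fun hs => innerSup_eq_max hlamα hα (hZ f hf) hs.1 hs.2 t _,
      fun hs => innerSup_eq_top hlamα hα (hZ f hf) hκ hs t _⟩,
    ⟨hfeas, fun _ => rfl, ?_, ?_⟩,
    ⟨exists_linearMap_eq_droObjective ρ,
      _, isSOCSet_conic_constraints (α := α) (lam := lam) sample h
        (LinearMap.fst ℝ (G.Decision n) ℝ).toAffineMap
        (LinearMap.snd ℝ (G.Decision n) ℝ).toAffineMap, ?_⟩,
    fun ⟨ℓ, hℓ⟩ => ⟨exists_linearMap_eq_droObjective ρ, ?_⟩⟩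
  · rw [MinProblem.value, MinProblem.value, hfeas]
    rfl
  · rw [MinProblem.minimizers, MinProblem.minimizers, hfeas]
    rfl
  · ext ⟨f, t, κ, s⟩
    constructor
    -- The epigraph constraint can be taken tight.
    · exact fun hx => ⟨Z₀ f, le_rfl, hx⟩
    · rintro ⟨r, hr, h0, h1, hrest⟩
      -- Lowering `r` to `Z₀ f` only relaxes the constraints, since both coefficients are
      -- nonnegative.
      have hr0 := mul_le_mul_of_nonneg_left hr (sub_nonneg.2 (effectiveWeight_le_one hlamα hα))
      have hr1 := mul_le_mul_of_nonneg_left hr (slope1_coeff_nonneg hlamα hα)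
      exact ⟨fun i => (add_le_add_right hr0 _).trans (h0 i),
        fun i => (add_le_add_right (sub_le_sub_right hr1 _) _).trans (h1 i), hrest⟩
  · convert isSOCSet_conic_constraints (α := α) (lam := lam) sample h
      (AffineMap.id ℝ (G.Decision n)) (ℓ.comp (LinearMap.fst ℝ _ _).toAffineMap) using 1
    -- `ℓ` agrees with `Z₀` only on feasible flows, but both sides include feasibility of `f`.
    ext ⟨f, t, κ, s⟩
    constructor
    · rintro ⟨h0, h1, hk0, hk1, hf⟩
      simp only [intercept0, intercept1, hℓ f hf] at h0 h1
      exact ⟨h0, h1, hk0, hk1, hf⟩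
    · rintro ⟨h0, h1, hk0, hk1, hf⟩
      refine ⟨?_, ?_, hk0, hk1, hf⟩ <;> simp only [intercept0, intercept1, hℓ f hf]
      · exact h0
      · exact h1
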